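/- Let $q$ be a power of a prime $p$, let $\varpi\in A=\mathbb F_q[T]$ be a monic irreducible polynomial, $\mathfrak p=(\varpi)$, and let $A_{\mathfrak p}$ be the $\mathfrak p$-adic completion of $A$ with its $\mathfrak p$-adic topology. Let $1+\mathfrak p^m$ denote the group of units $u$ of $A_{\mathfrak p}$ with $u\equiv 1 \bmod \mathfrak p^mA_{\mathfrak p}$, and let $$\Lambda_0=A_{\mathfrak p}\llbracket 1+\mathfrak p\rrbracket=\varprojlim_m\,(A_{\mathfrak p}/\mathfrak p^m)\bigl[(1+\mathfrak p)/(1+\mathfrak p^m)\bigr]$$ be the Iwasawa algebra of $1+\mathfrak p$ with its inverse limit topology; write $[u]\in\Lambda_0$ for the element given by $u\in 1+\mathfrak p$. For $u\in 1+\mathfrak p$ and $s\in\mathbb Z_p$ let $u^s\in A_{\mathfrak p}$ be the limit of the powers $u^{n}$ as $n\in\mathbb N$ tends $p$-adically to $s$. For $k\in\mathbb Z_p$ let $f_k:\Lambda_0\to A_{\mathfrak p}$ be the homomorphism of $A_{\mathfrak p}$-algebras obtained as the limit over $m$ of the $A_{\mathfrak p}/\mathfrak p^m$-linear maps $(A_{\mathfrak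 p}/\mathfrak p^m)[(1+\mathfrak p)/(1+\mathfrak p^m)]\to A_{\mathfrak p}/\mathfrak p^m$, $[u]\mapsto u^k$, and let $P_k=\ker f_k$. Let $\mathcal C(\mathbb Z_p,A_{\mathfrak p})$ be the $A_{\mathfrak p}$-algebra of continuous functions $\mathbb Z_p\to A_{\mathfrak p}$ with the topology of uniform convergence. Then: 1. There is a continuous homomorphism of $A_{\mathfrak p}$-algebras $\iota:\Lambda_0\to\mathcal C(\mathbb Z_p,A_{\mathfrak p})$ with $\iota([u])(s)=u^s$ for all $u\in 1+\mathfrak p$ and $s\in\mathbb Z_p$; it is the only continuous $A_{\mathfrak p}$-linear map with this property, and it is injective. 2. Every $P_k$, $k\in\mathbb Z_p$, is a prime ideal, and for every dense subset $I\subset\mathbb Z_p$ the set $\{P_k\}_{k\in I}$ is Zariski dense in $\operatorname{Spec}\Lambda_0$; moreover $\bigcap_{k\in I}P_k=0$. -/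

import Mathlib

open Polynomial

namespace IwasawaWeights

noncomputable section

section General

variable {R : Type*} [CommRing R] (J : Ideal R)

/-- The group of units `u` of `R` with `u ≡ 1` modulo `J ^ m`. -/
def higherUnits (m : ℕ) : Subgroup Rˣ where
  carrier := {u | (u : R) - 1 ∈ J ^ m}
  one_mem' := by simp
  mul_mem' := by
    intro a b ha hb
    have h : ((a * b : Rˣ) : R) - 1 = (a : R) * ((b : R) - 1) + ((a : R) - 1) := by
      push_cast; ring
    rw [Set.mem_ofPred_eq, h]
    exact Ideal.add_mem _ (Ideal.mul_mem_left _ _ hb) ha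
  inv_mem' := by
    intro a ha
    have h : ((a⁻¹ : Rˣ) : R) - 1 = -((a⁻¹ : Rˣ) : R) * ((a : R) - 1) := by
      have := a.inv_mul
      linear_combination this
    rw [Set.mem_ofPred_eq, h]
    exact Ideal.mul_mem_left _ _ ha

/-- The group `1 + J` (of units of `R`). -/
abbrev OneUnits : Type _ := higherUnits J 1

/-- `1 + J ^ m` as a subgroup of `1 + J`; for `m = 0` this is all of `1 + J`. -/
def levelSubgroup (m : ℕ) : Subgroup (OneUnits J) :=
  (higherUnits J m).subgroupOf (higherUnits J 1)

theorem mem_levelSubgroup {m : ℕ} {u : OneUnits J} :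
    u ∈ levelSubgroup J m ↔ ((u : Rˣ) : R) - 1 ∈ J ^ m := Iff.rfl

theorem levelSubgroup_antitone {m n : ℕ} (h : m ≤ n) :
    levelSubgroup J n ≤ levelSubgroup J m := fun _ hu => Ideal.pow_le_pow_right h hu

instance (m : ℕ) : CommGroup (OneUnits J ⧸ levelSubgroup J m) :=
  { QuotientGroup.Quotient.group (levelSubgroup J m) with
    mul_comm := by
      rintro ⟨a⟩ ⟨b⟩
      exact congrArg QuotientGroup.mk (mul_comm a b) }

/-- The group algebra `(R / J ^ m)[(1 + J) / (1 + J ^ m)]`. -/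
abbrev Level (m : ℕ) : Type _ :=
  MonoidAlgebra (R ⧸ J ^ m) (OneUnits J ⧸ levelSubgroup J m)

/-- The projection `(1 + J) / (1 + J ^ n) → (1 + J) / (1 + J ^ m)` for `m ≤ n`. -/
def quotientTransition {m n : ℕ} (h : m ≤ n) :
    (OneUnits J ⧸ levelSubgroup J n) →* (OneUnits J ⧸ levelSubgroup J m) :=
  QuotientGroup.map _ _ (MonoidHom.id _)
    (by rw [Subgroup.comap_id]; exact levelSubgroup_antitone J h)

/-- The projection from level `n` to level `m ≤ n`, reducing both the coefficients and the
group elements. -/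
def levelTransition {m n : ℕ} (h : m ≤ n) : Level J n →+* Level J m :=
  (MonoidAlgebra.mapDomainRingHom (R ⧸ J ^ m) (quotientTransition J h)).comp
    (MonoidAlgebra.mapRingHom (OneUnits J ⧸ levelSubgroup J n)
      (Ideal.Quotient.factorPow J h))

/-- The Iwasawa algebra `R⟦1 + J⟧ = lim_m (R / J ^ m)[(1 + J) / (1 + J ^ m)]`, as the
algebra of compatible sequences. -/
def iwasawaAlgebra : Subalgebra R (∀ m, Level J m) where
  carrier := {x | ∀ ⦃m n : ℕ⦄ (h : m ≤ n), levelTransition J h (x n) = x m}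
  mul_mem' := by
    intro a b ha hb m n h
    simp [ha h, hb h]
  add_mem' := by
    intro a b ha hb m n h
    simp [ha h, hb h]
  algebraMap_mem' := by
    intro r m n h
    simp [levelTransition]

/-- The inverse limit topology, every level being discrete. -/
instance : TopologicalSpace (iwasawaAlgebra J) :=
  ⨅ m : ℕ, TopologicalSpace.induced (fun x : iwasawaAlgebra J => (x : ∀ m, Level J m) m) ⊥

/-- The group element `[u]` of the Iwasawa algebra. -/
def groupElement : OneUnits J →* iwasawaAlgebra J where
  toFun u := ⟨fun m => MonoidAlgebra.of (R ⧸ J ^ m) (OneUnits J ⧸ levelSubgroup J m)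
      (QuotientGroup.mk u), by
    intro m n h
    simp [levelTransition, quotientTransition]⟩
  map_one' := by
    ext1; funext m; simp [MonoidAlgebra.one_def]
  map_mul' a b := by
    ext1; funext m; simp

section Powers

variable (p : ℕ)

theorem pow_prime_pow_sub_one_mem (hp : (p : R) ∈ J) {u : R} (hu : u - 1 ∈ J) (m : ℕ) :
    u ^ p ^ m - 1 ∈ J ^ m := by
  induction m with
  | zero => simp
  | succ m ih =>
    have hpow : ∀ i : ℕ, (u ^ p ^ m) ^ i - 1 ∈ J := fun i => by
      rw [← pow_mul]
      exact J.mem_of_dvd (by simpa using sub_dvd_pow_sub_pow u 1 (p ^ m * i)) hu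
    have hsum : ∑ i ∈ Finset.range p, (u ^ p ^ m) ^ i ∈ J := by
      have h : ∑ i ∈ Finset.range p, (u ^ p ^ m) ^ i
          = ∑ i ∈ Finset.range p, ((u ^ p ^ m) ^ i - 1) + (p : R) := by simp
      rw [h]
      exact J.add_mem (J.sum_mem fun i _ => hpow i) hp
    rw [pow_succ p m, pow_mul, ← mul_geom_sum, pow_succ]
    exact Ideal.mul_mem_mul ih hsum

theorem pow_sub_pow_mem (hp : (p : R) ∈ J) {u : R} (hu : u - 1 ∈ J) {m a b : ℕ}
    (h : a ≡ b [MOD p ^ m]) : u ^ a - u ^ b ∈ J ^ m := by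
  have key : ∀ {a b : ℕ}, a ≤ b → a ≡ b [MOD p ^ m] → u ^ b - u ^ a ∈ J ^ m := by
    intro a b hab h
    obtain ⟨c, hc⟩ := (Nat.modEq_iff_dvd' hab).1 h
    obtain rfl : b = a + p ^ m * c := by omega
    have : u ^ (a + p ^ m * c) - u ^ a = u ^ a * ((u ^ p ^ m) ^ c - 1) := by
      rw [pow_add, pow_mul]; ring
    rw [this]
    exact Ideal.mul_mem_left _ _ ((J ^ m).mem_of_dvd
      (by simpa using sub_dvd_pow_sub_pow (u ^ p ^ m) 1 c)
      (pow_prime_pow_sub_one_mem J p hp hu m))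
  rcases le_total a b with hab | hab
  · rw [← neg_sub]
    exact (J ^ m).neg_mem (key hab h)
  · exact key hab h.symm

theorem OneUnits.sub_one_mem (u : OneUnits J) : ((u : Rˣ) : R) - 1 ∈ J := by
  have h : ((u : Rˣ) : R) - 1 ∈ J ^ 1 := u.2
  rwa [pow_one] at h

theorem eq_of_forall_mk_eq [IsHausdorff J R] {a b : R}
    (h : ∀ m : ℕ, Ideal.Quotient.mk (J ^ m) a = Ideal.Quotient.mk (J ^ m) b) : a = b := by
  rw [IsHausdorff.eq_iff_smodEq (I := J)]
  intro m
  rw [SModEq.sub_mem]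
  simpa using (Ideal.Quotient.mk_eq_mk_iff_sub_mem _ _).1 (h m)

variable [hprime : Fact p.Prime] [hp : Fact ((p : R) ∈ J)] [IsAdicComplete J R]

theorem exists_padicPow (u : OneUnits J) (s : ℤ_[p]) :
    ∃ L : R, ∀ m : ℕ, ((u : Rˣ) : R) ^ s.appr m - L ∈ J ^ m := by
  obtain ⟨L, hL⟩ := IsPrecomplete.prec (I := J) (M := R) inferInstance
    (f := fun m => ((u : Rˣ) : R) ^ s.appr m) (fun {m n} hmn => by
      rw [SModEq.sub_mem]
      simpa using pow_sub_pow_mem J p hp.out (OneUnits.sub_one_mem J u)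
        ((Nat.modEq_iff_dvd' (PadicInt.appr_mono s hmn)).2
          (PadicInt.dvd_appr_sub_appr s m n hmn)))
  exact ⟨L, fun m => by simpa [SModEq.sub_mem] using hL m⟩

/-- The power `u ^ s` of `u ∈ 1 + J` with exponent `s ∈ ℤ_p`: the `J`-adic limit of the powers
`u ^ s_m`, where `s_m` is the natural number `< p ^ m` congruent to `s` modulo `p ^ m`. -/
def padicPow (u : OneUnits J) (s : ℤ_[p]) : R := (exists_padicPow J p u s).choose

theorem padicPow_spec (u : OneUnits J) (s : ℤ_[p]) (m : ℕ) :
    Ideal.Quotient.mk (J ^ m) (padicPow J p u s)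
      = Ideal.Quotient.mk (J ^ m) (((u : Rˣ) : R) ^ s.appr m) :=
  ((Ideal.Quotient.mk_eq_mk_iff_sub_mem _ _).2
    ((exists_padicPow J p u s).choose_spec m)).symm

/-- For natural exponents `padicPow` is the usual power. -/
theorem padicPow_natCast (u : OneUnits J) (n : ℕ) :
    padicPow J p u (n : ℤ_[p]) = ((u : Rˣ) : R) ^ n := by
  refine eq_of_forall_mk_eq J fun m => ?_
  rw [padicPow_spec]
  refine (Ideal.Quotient.mk_eq_mk_iff_sub_mem _ _).2
    (pow_sub_pow_mem J p hp.out (OneUnits.sub_one_mem J u) ?_)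
  have h := PadicInt.appr_spec m (n : ℤ_[p])
  rw [← PadicInt.ker_toZModPow, RingHom.mem_ker, map_sub, map_natCast, map_natCast,
    sub_eq_zero] at h
  exact ((ZMod.natCast_eq_natCast_iff _ _ _).1 h).symm

/-- The character `u ↦ u ^ k` of `1 + J`. -/
def weightHom (k : ℤ_[p]) : OneUnits J →* R where
  toFun u := padicPow J p u k
  map_one' := eq_of_forall_mk_eq J fun m => by simp [padicPow_spec]
  map_mul' a b := eq_of_forall_mk_eq J fun m => by simp [padicPow_spec, mul_pow]

/-- The character `(1 + J) / (1 + J ^ m) → R / J ^ m` induced by `u ↦ u ^ k`. -/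
def weightHomLevel (k : ℤ_[p]) (m : ℕ) : (OneUnits J ⧸ levelSubgroup J m) →* R ⧸ J ^ m :=
  QuotientGroup.lift (levelSubgroup J m)
    (((Ideal.Quotient.mk (J ^ m) : R →+* R ⧸ J ^ m) : R →* R ⧸ J ^ m).comp (weightHom J p k))
    (by
      intro u hu
      have h : Ideal.Quotient.mk (J ^ m) ((u : Rˣ) : R) = 1 := by
        rw [← map_one (Ideal.Quotient.mk (J ^ m))]
        exact (Ideal.Quotient.mk_eq_mk_iff_sub_mem _ _).2 hu
      simp [MonoidHom.mem_ker, weightHom, padicPow_spec, h])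

/-- The map `(R / J ^ m)[(1 + J) / (1 + J ^ m)] → R / J ^ m` which is linear over `R / J ^ m`
and sends the class of `u` to the class of `u ^ k`. -/
def specializationLevel (k : ℤ_[p]) (m : ℕ) : Level J m →ₐ[R ⧸ J ^ m] R ⧸ J ^ m :=
  MonoidAlgebra.lift (R ⧸ J ^ m) (R ⧸ J ^ m) (OneUnits J ⧸ levelSubgroup J m)
    (weightHomLevel J p k m)

theorem factorPow_specializationLevel (k : ℤ_[p]) {m n : ℕ} (h : m ≤ n) (x : Level J n) :
    Ideal.Quotient.factorPow J h (specializationLevel J p k n x)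
      = specializationLevel J p k m (levelTransition J h x) := by
  induction x using MonoidAlgebra.induction_linear with
  | zero => simp
  | add f g hf hg => simp only [map_add, hf, hg]
  | single u r =>
    induction u using QuotientGroup.induction_on with
    | H u =>
      obtain ⟨r, rfl⟩ := Ideal.Quotient.mk_surjective r
      simp [specializationLevel, levelTransition]
      rfl

/-- The composition of `specializationLevel` with the projection to level `m`. -/
def specializationProj (k : ℤ_[p]) (m : ℕ) : iwasawaAlgebra J →ₐ[R] R ⧸ J ^ m :=
  ((specializationLevel J p k m).restrictScalars R).comp
    ((Pi.evalAlgHom R (Level J) m).comp (iwasawaAlgebra J).val)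

theorem factor_comp_specializationProj (k : ℤ_[p]) {m n : ℕ} (h : m ≤ n) :
    (Ideal.Quotient.factorₐ R (Ideal.pow_le_pow_right h)).comp (specializationProj J p k n)
      = specializationProj J p k m := by
  refine AlgHom.ext fun x => ?_
  have hx := factorPow_specializationLevel J p k h ((x : ∀ m, Level J m) n)
  rw [x.2 h] at hx
  exact hx

/-- The specialization `f_k : R⟦1 + J⟧ → R` at weight `k ∈ ℤ_p`, `[u] ↦ u ^ k`: the limit
over `m` of the maps `specializationLevel`. -/
def specialization (k : ℤ_[p]) : iwasawaAlgebra J →ₐ[R] R :=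
  IsAdicComplete.liftAlgHom (R := R) (A := iwasawaAlgebra J) J (specializationProj J p k)
    (factor_comp_specializationProj J p k)

theorem specialization_groupElement (k : ℤ_[p]) (u : OneUnits J) :
    specialization J p k (groupElement J u) = padicPow J p u k := by
  refine eq_of_forall_mk_eq J fun m => ?_
  unfold specialization
  rw [IsAdicComplete.mk_liftAlgHom]
  simp [groupElement, specializationProj, specializationLevel, weightHomLevel, weightHom]

/-- The weight ideal `P_k`, the kernel of `f_k`. -/
def weightIdeal (k : ℤ_[p]) : Ideal (iwasawaAlgebra J) := RingHom.ker (specialization J p k)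

end Powers

end General

section Completion

variable {F : Type*} [Field F] (ϖ : F[X])

/-- The `𝔭`-adic completion `A_𝔭` of `A = F[X]` for `𝔭 = (ϖ)`. -/
abbrev CompletedRing : Type _ := AdicCompletion (Ideal.span {ϖ}) F[X]

/-- The ideal `𝔭 A_𝔭` of `A_𝔭`. -/
def completedIdeal : Ideal (CompletedRing ϖ) :=
  (Ideal.span {ϖ}).map (algebraMap F[X] (CompletedRing ϖ))

/-- The `𝔭`-adic topology of `A_𝔭`. -/
instance : TopologicalSpace (CompletedRing ϖ) := (completedIdeal ϖ).adicTopology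

instance : IsTopologicalRing (CompletedRing ϖ) :=
  (completedIdeal ϖ).nonarchimedean.toIsTopologicalRing

instance : IsAdicComplete (completedIdeal ϖ) (CompletedRing ϖ) :=
  (IsAdicComplete.map_algebraMap_iff (Ideal.span {ϖ}) (CompletedRing ϖ)).2
    (AdicCompletion.isAdicComplete ⟨{ϖ}, by simp⟩)

instance (p : ℕ) [CharP F p] : Fact ((p : CompletedRing ϖ) ∈ completedIdeal ϖ) :=
  ⟨by
    have h : (p : CompletedRing ϖ) = algebraMap F[X] (CompletedRing ϖ) (p : F[X]) :=
      (map_natCast _ p).symm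
    rw [h, CharP.cast_eq_zero F[X] p, map_zero]
    exact Ideal.zero_mem _⟩

end Completion

end

end IwasawaWeights

open IwasawaWeights

/-! The map `ι` sends `x` to `s ↦ f_s(x)`. Modulo `J ^ m` this value depends only on the level-`m`
component of `x` and on `s` modulo `p ^ m`, which gives all the continuity; uniqueness follows
because the span of the group elements is dense. The real content is injectivity, for which natural
weights suffice (`eq_zero_of_forall_specialization_natCast`). Pairing `x` with a polynomial function
of `u` is a linear combination of the values `f_i(x)`, hence zero. By
`exists_polynomial_approx_indicator`, polynomials approximate `π ^ r` times the indicator function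
of a residue class. Each coefficient of `x` is therefore killed by multiplication by `π ^ r` from `R
/ J ^ m` to `R / J ^ (m + r)`, which is injective. Each `P_k` is prime because `A_𝔭` is a domain.
For dense `I`, a continuous function vanishing on `I` is zero, so injectivity gives `⋂ P_k = 0`, and
Zariski density follows. -/

namespace IwasawaWeights

noncomputable section

/-! ### Polynomial approximation of indicator functions; a domain criterion. -/

section Approximation

variable {R : Type*} [CommRing R] {π : R}

/-- Up to a power of `π`, the indicator function of a residue class modulo `π ^ j` is uniformly
approximated by polynomial functions, provided the residue ring modulo `π` is a finite field. -/
theorem exists_polynomial_approx_indicator {p N : ℕ} (hprime : p.Prime) (hp : π ∣ (p : R))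
    (hN : 0 < N) (hpow : ∀ y : R, ¬ π ∣ y → π ∣ y ^ N - 1) (a : R) (j M : ℕ) :
    ∃ (r : ℕ) (Q : R[X]), (∀ u, π ^ j ∣ u - a → π ^ (M + r) ∣ Q.eval u - π ^ r) ∧
      ∀ u, ¬ π ^ j ∣ u - a → π ^ (M + r) ∣ Q.eval u := by
  induction j generalizing M with
  | zero => exact ⟨0, 1, by simp, by simp⟩
  | succ j ih =>
    -- The extra precision `j + 1` makes `Q(u)` divisible by `π ^ (r + j + 1)` off the old class, as
    -- `hsmall` requires.
    obtain ⟨r, Q, hQ₁, hQ₀⟩ := ih (M + (j + 1))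
    -- A `K`-th power is `1` modulo `π ^ M` if `π` does not divide the base; `K ≥ M` makes the other
    -- powers negligible.
    set K := N * p ^ M
    have hMK : M ≤ K := (Nat.lt_pow_self hprime.one_lt).le.trans (Nat.le_mul_of_pos_left _ hN)
    have hK0 : 0 < K := Nat.mul_pos hN (Nat.pow_pos hprime.pos)
    have hpowK : ∀ y : R, ¬ π ∣ y → π ^ M ∣ y ^ K - 1 := fun y hy => by
      have h := pow_prime_pow_sub_one_mem (Ideal.span {π}) p
        (Ideal.mem_span_singleton.2 hp) (Ideal.mem_span_singleton.2 (hpow y hy)) M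
      rwa [Ideal.span_singleton_pow, Ideal.mem_span_singleton, ← pow_mul] at h
    obtain ⟨t, ht⟩ : ∃ t, (r + j) * K = r + t :=
      Nat.exists_eq_add_of_le ((Nat.le_add_right r j).trans (Nat.le_mul_of_pos_right _ hK0))
    have hsmall : ∀ w : R, π ^ (r + j + 1) ∣ w → π ^ (M + (r + j) * K) ∣ w ^ K := by
      rintro w ⟨y, rfl⟩
      have : (π ^ (r + j + 1) * y) ^ K = π ^ ((r + j) * K) * π ^ K * y ^ K := by
        rw [mul_pow, ← pow_mul, ← pow_add]; ring_nf
      rw [this, ← pow_add]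
      exact (pow_dvd_pow π (by omega)).mul_right _
    have heval : ∀ u, (C (π ^ t) * Q - (Q * (X - C a)) ^ K).eval u
        = π ^ t * Q.eval u - (Q.eval u * (u - a)) ^ K := fun u => by simp
    -- On the class modulo `π ^ j`, `Q(u)(u - a)` is about `π ^ (r + j) * z` with `u - a = π ^ j *
    -- z`. Its `K`-th power is about `π ^ ((r + j) * K)` if `π ∤ z`, cancelling the first term, and
    -- negligible if `π ∣ z`.
    refine ⟨(r + j) * K, C (π ^ t) * Q - (Q * (X - C a)) ^ K, fun u hu => ?_, fun u hu => ?_⟩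
    · obtain ⟨x, hx⟩ := hQ₁ u ((pow_dvd_pow π j.le_succ).trans hu)
      obtain ⟨z, hz⟩ := hu
      have hx' : Q.eval u = π ^ r * (1 + π ^ (M + (j + 1)) * x) := by
        rw [sub_eq_iff_eq_add] at hx; rw [hx]; ring
      have h₁ : π ^ (M + (r + j) * K) ∣ π ^ t * Q.eval u - π ^ ((r + j) * K) := by
        refine ⟨π ^ (j + 1) * x, ?_⟩
        rw [hx', ht]; ring
      have h₂ := hsmall (Q.eval u * (u - a))
        ⟨(1 + π ^ (M + (j + 1)) * x) * z, by rw [hx', hz]; ring⟩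
      rw [heval, sub_right_comm]
      exact dvd_sub h₁ h₂
    · rw [heval]
      by_cases hj : π ^ j ∣ u - a
      · obtain ⟨x, hx⟩ := hQ₁ u hj
        obtain ⟨z, hz⟩ := hj
        have hzπ : ¬ π ∣ z := by
          rintro ⟨z', rfl⟩
          exact hu ⟨z', by rw [hz]; ring⟩
        have hx' : Q.eval u = π ^ r * (1 + π ^ (M + (j + 1)) * x) := by
          rw [sub_eq_iff_eq_add] at hx; rw [hx]; ring
        have hy : ¬ π ∣ (1 + π ^ (M + (j + 1)) * x) * z := fun h => hzπ <| by
          have h' : π ∣ π ^ (M + (j + 1)) * x * z :=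
            ((dvd_pow_self π (by omega)).mul_right x).mul_right z
          have := dvd_sub h h'
          rwa [add_mul, one_mul, add_sub_cancel_right] at this
        obtain ⟨c, hc⟩ := hpowK _ hy
        refine ⟨π ^ (j + 1) * x - c, ?_⟩
        have h₁ : (Q.eval u * (u - a)) ^ K
            = π ^ ((r + j) * K) * (1 + π ^ M * c) := by
          rw [← sub_eq_iff_eq_add'.1 hc, hx', hz, pow_mul π, ← mul_pow]; ring
        rw [h₁, hx', ht]; ring
      · obtain ⟨x, hx⟩ := hQ₀ u hj
        refine dvd_sub ⟨π ^ (j + 1) * x, ?_⟩ (hsmall _ ⟨π ^ M * x * (u - a), ?_⟩)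
        · rw [hx, ht]; ring
        · rw [hx]; ring

/-- A ring that is Hausdorff for the topology of a principal prime ideal with regular generator
is a domain. -/
theorem isDomain_of_isHausdorff_span [IsHausdorff (Ideal.span {π}) R]
    (hπ : Prime π) (hreg : IsLeftRegular π) : IsDomain R := by
  have : Nontrivial R := ⟨π, 0, hπ.ne_zero⟩
  -- Hausdorffness bounds the powers of `π` dividing a nonzero `x`, so a maximal one can be split
  -- off.
  have factor : ∀ x : R, x ≠ 0 → ∃ n y, ¬ π ∣ y ∧ x = π ^ n * y := fun x hx => by
    have : ∃ n, ¬ π ^ n ∣ x := by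
      by_contra! h
      refine hx (eq_of_forall_mk_eq (Ideal.span {π}) fun m => ?_)
      rw [Ideal.Quotient.mk_eq_mk_iff_sub_mem, Ideal.span_singleton_pow,
        Ideal.mem_span_singleton, sub_zero]
      exact h m
    obtain ⟨n, hn, hmin⟩ : ∃ n, ¬ π ^ (n + 1) ∣ x ∧ π ^ n ∣ x := by
      classical
      have h0 : Nat.find this ≠ 0 := fun h => Nat.find_spec this (by simp [h])
      obtain ⟨n, hn⟩ := Nat.exists_eq_succ_of_ne_zero h0
      exact ⟨n, by have := Nat.find_spec this; rwa [hn] at this,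
        not_not.1 (Nat.find_min this (m := n) (by omega))⟩
    obtain ⟨y, rfl⟩ := hmin
    exact ⟨n, y, fun ⟨z, hz⟩ => hn ⟨z, by rw [hz]; ring⟩, rfl⟩
  have : NoZeroDivisors R := ⟨fun {x y} hxy => by
    by_contra! h
    obtain ⟨n, x', hx', rfl⟩ := factor x h.1
    obtain ⟨m, y', hy', rfl⟩ := factor y h.2
    have h0 : π ^ (n + m) * (x' * y') = π ^ (n + m) * 0 := by
      rw [mul_zero, ← hxy]; ring
    have := hreg.pow (n + m) h0
    exact (hπ.dvd_or_dvd (this ▸ dvd_zero π)).elim hx' hy'⟩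
  exact NoZeroDivisors.to_isDomain R

end Approximation

/-! ### Separation of elements by natural weights. -/

section Injectivity

variable {R : Type*} [CommRing R] {J : Ideal R}

theorem levelTransition_single {m n : ℕ} (h : m ≤ n) (u : OneUnits J) (c : R) :
    levelTransition J h
        (MonoidAlgebra.single (QuotientGroup.mk u) (Ideal.Quotient.mk (J ^ n) c))
      = MonoidAlgebra.single (QuotientGroup.mk u) (Ideal.Quotient.mk (J ^ m) c) := by
  simp [levelTransition, quotientTransition]

/-- Cosets of `1 + J ^ m` are thus residue classes modulo `J ^ m`, the sets whose indicators are
approximated. -/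
theorem mk_eq_mk_iff_sub_mem {m : ℕ} {u v : OneUnits J} :
    (QuotientGroup.mk u : OneUnits J ⧸ levelSubgroup J m) = QuotientGroup.mk v ↔
      ((u : Rˣ) : R) - ((v : Rˣ) : R) ∈ J ^ m := by
  rw [eq_comm, QuotientGroup.eq, mem_levelSubgroup]
  have h : (((v⁻¹ * u : OneUnits J) : Rˣ) : R) - 1
      = (((v : Rˣ)⁻¹ : Rˣ) : R) * (((u : Rˣ) : R) - ((v : Rˣ) : R)) := by
    simp [mul_sub]
  rw [h]
  exact Ideal.unit_mul_mem_iff_mem _ (Units.isUnit _)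

variable {p : ℕ} [hprime : Fact p.Prime] [hp : Fact ((p : R) ∈ J)] [IsAdicComplete J R]

theorem mk_specialization (k : ℤ_[p]) (x : iwasawaAlgebra J) (m : ℕ) :
    Ideal.Quotient.mk (J ^ m) (specialization J p k x)
      = specializationLevel J p k m ((x : ∀ m, Level J m) m) := by
  unfold specialization
  rw [IsAdicComplete.mk_liftAlgHom]
  rfl

theorem specializationLevel_single (k : ℤ_[p]) (m : ℕ) (u : OneUnits J) (c : R) :
    specializationLevel J p k m
        (MonoidAlgebra.single (QuotientGroup.mk u) (Ideal.Quotient.mk (J ^ m) c))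
      = Ideal.Quotient.mk (J ^ m) (c * padicPow J p u k) := by
  simp [specializationLevel, weightHomLevel, weightHom]

/-- An element of the Iwasawa algebra killed by the specializations at all natural weights
vanishes. -/
theorem eq_zero_of_forall_specialization_natCast {π : R} (hJ : J = Ideal.span {π})
    (hreg : IsLeftRegular π) {N : ℕ} (hN : 0 < N) (hpow : ∀ y : R, ¬ π ∣ y → π ∣ y ^ N - 1)
    {x : iwasawaAlgebra J} (hx : ∀ i : ℕ, specialization J p (i : ℤ_[p]) x = 0) : x = 0 := by
  have memJ : ∀ {n : ℕ} {a : R}, a ∈ J ^ n ↔ π ^ n ∣ a := fun {n a} => by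
    rw [hJ, Ideal.span_singleton_pow, Ideal.mem_span_singleton]
  refine Subtype.ext (funext fun m => ?_)
  refine MonoidAlgebra.ext (Finsupp.ext fun g => ?_)
  obtain ⟨v, rfl⟩ := QuotientGroup.mk_surjective g
  obtain ⟨r, Q, hQ₁, hQ₀⟩ := exists_polynomial_approx_indicator hprime.out
    (by simpa using memJ (n := 1).1 (by simpa using hp.out)) hN hpow ((v : Rˣ) : R) m m
  let φ : (R ⧸ J ^ m) →ₗ[R] R ⧸ J ^ (m + r) :=
    Submodule.mapQ (J ^ m) (J ^ (m + r)) (LinearMap.mulLeft R (π ^ r)) fun a ha => by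
      obtain ⟨b, rfl⟩ := memJ.1 ha
      exact memJ.2 ⟨b, by rw [LinearMap.mulLeft_apply]; ring⟩
  have hφ : ∀ a : R, φ (Ideal.Quotient.mk _ a) = Ideal.Quotient.mk _ (π ^ r * a) := fun _ => rfl
  have hφinj : ∀ a, φ a = 0 → a = 0 := fun a => by
    obtain ⟨a, rfl⟩ := Ideal.Quotient.mk_surjective a
    rw [hφ, Ideal.Quotient.eq_zero_iff_mem, Ideal.Quotient.eq_zero_iff_mem, memJ, memJ]
    rintro ⟨b, hb⟩
    exact ⟨b, hreg.pow r (by beta_reduce; rw [hb]; ring)⟩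
  -- Both sides are additive in `y`. On `c[u]` the left side is `c * Q(u)`, which is `π ^ r * c` or
  -- `0` modulo `π ^ (m + r)` according to whether `u` lies in the class of `v`.
  have key : ∀ y : Level J (m + r),
      Q.sum (fun i q => Ideal.Quotient.mk _ q * specializationLevel J p (i : ℤ_[p]) (m + r) y)
        = φ ((levelTransition J (Nat.le_add_right m r) y).coeff (QuotientGroup.mk v)) := fun y => by
    induction y using MonoidAlgebra.induction_linear with
    | zero => simp [Polynomial.sum]
    | add y z hy hz =>
      simp only [map_add, mul_add, MonoidAlgebra.coeff_add, Finsupp.add_apply, ← hy, ← hz,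
        Polynomial.sum, Finset.sum_add_distrib]
    | single g c =>
      obtain ⟨u, rfl⟩ := QuotientGroup.mk_surjective g
      obtain ⟨c, rfl⟩ := Ideal.Quotient.mk_surjective c
      have h : Q.sum (fun i q => Ideal.Quotient.mk (J ^ (m + r)) q *
          Ideal.Quotient.mk _ (c * ((u : Rˣ) : R) ^ i))
          = Ideal.Quotient.mk _ (c * Q.eval ((u : Rˣ) : R)) := by
        simp only [Polynomial.eval_eq_sum, Polynomial.sum, Finset.mul_sum, map_sum, ← map_mul]
        exact Finset.sum_congr rfl fun i _ => by ring_nf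
      simp only [specializationLevel_single, padicPow_natCast, levelTransition_single]
      rw [h]
      classical
      rw [MonoidAlgebra.coeff_single, Finsupp.single_apply]
      split_ifs with huv
      · rw [mk_eq_mk_iff_sub_mem, memJ] at huv
        rw [hφ, Ideal.Quotient.mk_eq_mk_iff_sub_mem, memJ, mul_comm (π ^ r), ← mul_sub]
        exact (hQ₁ _ huv).mul_left _
      · rw [mk_eq_mk_iff_sub_mem, memJ] at huv
        rw [map_zero, Ideal.Quotient.eq_zero_iff_mem, memJ]
        exact (hQ₀ _ huv).mul_left _
  have h := key ((x : ∀ m, Level J m) (m + r))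
  simp only [← mk_specialization, hx, map_zero, mul_zero] at h
  rw [x.2 (Nat.le_add_right m r)] at h
  exact hφinj _ (by rw [← h]; simp [Polynomial.sum])

end Injectivity

/-! ### Continuity, uniqueness and dense sets of weights. -/

section Topology

open Topology Filter

variable {R : Type*} [CommRing R] {J : Ideal R}

theorem hasBasis_nhds_iwasawaAlgebra (x : iwasawaAlgebra J) :
    (𝓝 x).HasBasis (fun _ : ℕ => True)
      fun m => {y | (y : ∀ m, Level J m) m = (x : ∀ m, Level J m) m} := by
  have h : 𝓝 x = ⨅ m : ℕ, 𝓟 {y : iwasawaAlgebra J |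
      (y : ∀ m, Level J m) m = (x : ∀ m, Level J m) m} := by
    rw [nhds_iInf]
    refine iInf_congr fun m => ?_
    let : TopologicalSpace (Level J m) := ⊥
    have : DiscreteTopology (Level J m) := ⟨rfl⟩
    rw [nhds_induced, nhds_discrete, comap_pure]
    rfl
  rw [h]
  -- Agreement at level `n` forces agreement at lower levels, so single levels form a basis.
  refine hasBasis_iInf_principal (directed_of_isDirected_le fun m n hmn y hy => ?_)
  have hy' : (y : ∀ m, Level J m) n = (x : ∀ m, Level J m) n := hy
  change (y : ∀ m, Level J m) m = (x : ∀ m, Level J m) m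
  rw [← y.2 hmn, ← x.2 hmn, hy']

theorem dense_span_range_groupElement :
    Dense (Submodule.span R (Set.range (groupElement J)) : Set (iwasawaAlgebra J)) := by
  intro x
  rw [mem_closure_iff_nhds_basis (hasBasis_nhds_iwasawaAlgebra x)]
  intro m _
  have key : ∀ y : Level J m, ∃ z ∈ Submodule.span R (Set.range (groupElement J)),
      (z : ∀ m, Level J m) m = y := fun y => by
    induction y using MonoidAlgebra.induction_linear with
    | zero => exact ⟨0, zero_mem _, rfl⟩
    | add y y' hy hy' =>
      obtain ⟨z, hz, rfl⟩ := hy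
      obtain ⟨z', hz', rfl⟩ := hy'
      exact ⟨z + z', add_mem hz hz', rfl⟩
    | single g c =>
      obtain ⟨u, rfl⟩ := QuotientGroup.mk_surjective g
      obtain ⟨c, rfl⟩ := Ideal.Quotient.mk_surjective c
      refine ⟨c • groupElement J u,
        Submodule.smul_mem _ _ (Submodule.subset_span ⟨u, rfl⟩), ?_⟩
      change c • MonoidAlgebra.single (QuotientGroup.mk u : OneUnits J ⧸ levelSubgroup J m)
        (1 : R ⧸ J ^ m) = _
      rw [MonoidAlgebra.smul_single, Algebra.smul_def, mul_one]
      rfl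
  obtain ⟨z, hz, hzx⟩ := key ((x : ∀ m, Level J m) m)
  exact ⟨z, hz, hzx⟩

section AdicTarget

variable [TopologicalSpace R]

theorem continuous_of_eventually_mk_eq (hJ : IsAdic J) {Y : Type*} [TopologicalSpace Y]
    {f : Y → R} (h : ∀ (m : ℕ) (y : Y),
      ∀ᶠ z in 𝓝 y, Ideal.Quotient.mk (J ^ m) (f z) = Ideal.Quotient.mk (J ^ m) (f y)) :
    Continuous f := by
  refine continuous_iff_continuousAt.2 fun y => ?_
  refine (hJ.hasBasis_nhds (f y)).tendsto_right_iff.2 fun m _ => ?_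
  filter_upwards [h m y] with z hz
  exact ⟨f z - f y, (Ideal.Quotient.mk_eq_mk_iff_sub_mem _ _).1 hz, by simp⟩

theorem t2Space_of_isAdic [IsTopologicalRing R] (hJ : IsAdic J) [IsHausdorff J R] : T2Space R := by
  refine IsTopologicalAddGroup.t2Space_of_zero_sep fun x hx => ?_
  by_contra! h
  refine hx (eq_of_forall_mk_eq J fun m => ?_)
  rw [Ideal.Quotient.mk_eq_mk_iff_sub_mem, sub_zero]
  exact h _ (hJ.hasBasis_nhds_zero.mem_of_mem (i := m) trivial)

end AdicTarget

variable {p : ℕ} [hprime : Fact p.Prime]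

theorem eventually_appr_modEq (m : ℕ) (s : ℤ_[p]) :
    ∀ᶠ t in 𝓝 s, t.appr m ≡ s.appr m [MOD p ^ m] := by
  have happr : ∀ t : ℤ_[p], PadicInt.toZModPow m t = (t.appr m : ZMod (p ^ m)) := fun t => by
    have h := PadicInt.appr_spec m t
    rwa [← PadicInt.ker_toZModPow, RingHom.mem_ker, map_sub, map_natCast, sub_eq_zero] at h
  have hpos : (0 : ℝ) < (p : ℝ) ^ (-m : ℤ) :=
    zpow_pos (Nat.cast_pos.2 hprime.out.pos) _
  filter_upwards [Metric.closedBall_mem_nhds s hpos] with t ht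
  rw [mem_closedBall_iff_norm, PadicInt.norm_le_pow_iff_mem_span_pow,
    ← PadicInt.ker_toZModPow, RingHom.mem_ker, map_sub, sub_eq_zero, happr, happr] at ht
  exact (ZMod.natCast_eq_natCast_iff _ _ _).1 ht

variable [hp : Fact ((p : R) ∈ J)] [IsAdicComplete J R]

/-- Holds because `u ^ (p ^ m) ≡ 1` modulo `J ^ m` for `u ∈ 1 + J`. -/
theorem specializationLevel_congr {m : ℕ} {s t : ℤ_[p]}
    (h : s.appr m ≡ t.appr m [MOD p ^ m]) :
    specializationLevel J p s m = specializationLevel J p t m := by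
  refine congrArg (MonoidAlgebra.lift (R ⧸ J ^ m) (R ⧸ J ^ m) (OneUnits J ⧸ levelSubgroup J m))
    (MonoidHom.ext fun g => ?_)
  obtain ⟨u, rfl⟩ := QuotientGroup.mk_surjective g
  change Ideal.Quotient.mk (J ^ m) (padicPow J p u s) = Ideal.Quotient.mk _ (padicPow J p u t)
  rw [padicPow_spec, padicPow_spec, Ideal.Quotient.mk_eq_mk_iff_sub_mem]
  exact pow_sub_pow_mem J p hp.out (OneUnits.sub_one_mem J u) h

variable [TopologicalSpace R]

variable (p) in
-- Joint continuity serves twice: it makes each `s ↦ f_s(x)` continuous and, by currying, `ι`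
-- continuous for uniform convergence.
theorem continuous_uncurry_specialization (hJ : IsAdic J) :
    Continuous (Function.uncurry fun (x : iwasawaAlgebra J) (s : ℤ_[p]) =>
      specialization J p s x) := by
  refine continuous_of_eventually_mk_eq hJ fun m ⟨x, s⟩ => ?_
  filter_upwards [prod_mem_nhds ((hasBasis_nhds_iwasawaAlgebra x).mem_of_mem (i := m) trivial)
    (eventually_appr_modEq m s)] with ⟨y, t⟩ ⟨hy, ht⟩
  have hy' : (y : ∀ m, Level J m) m = (x : ∀ m, Level J m) m := hy
  rw [Function.uncurry_apply_pair, Function.uncurry_apply_pair, mk_specialization,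
    mk_specialization, hy', specializationLevel_congr ht]

variable [IsTopologicalRing R]

variable (p) in
/-- The map sending `x` in the Iwasawa algebra to the function `s ↦ f_s(x)`. -/
def weightInterpolation (hJ : IsAdic J) : iwasawaAlgebra J →ₐ[R] C(ℤ_[p], R) where
  toFun x := ⟨fun s => specialization J p s x,
    (continuous_uncurry_specialization p hJ).uncurry_left x⟩
  map_one' := ContinuousMap.ext fun s => map_one (specialization J p s)
  map_mul' x y := ContinuousMap.ext fun s => map_mul (specialization J p s) x y
  map_zero' := ContinuousMap.ext fun s => map_zero (specialization J p s)
  map_add' x y := ContinuousMap.ext fun s => map_add (specialization J p s) x y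
  commutes' r := ContinuousMap.ext fun s => (specialization J p s).commutes r

@[simp]
theorem weightInterpolation_apply (hJ : IsAdic J) (x : iwasawaAlgebra J) (s : ℤ_[p]) :
    weightInterpolation p hJ x s = specialization J p s x := rfl

theorem continuous_weightInterpolation (hJ : IsAdic J) :
    Continuous (weightInterpolation p hJ) :=
  ContinuousMap.continuous_of_continuous_uncurry _ (continuous_uncurry_specialization p hJ)

theorem eq_weightInterpolation (hJ : IsAdic J) {ι : iwasawaAlgebra J →ₗ[R] C(ℤ_[p], R)}
    (hι : Continuous ι) (h : ∀ (u : OneUnits J) (s : ℤ_[p]),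
      ι (groupElement J u) s = padicPow J p u s) :
    ι = (weightInterpolation p hJ).toLinearMap := by
  have := t2Space_of_isAdic hJ
  refine DFunLike.coe_injective (hι.ext_on dense_span_range_groupElement
    (continuous_weightInterpolation hJ) fun x hx => ?_)
  refine LinearMap.eqOn_span (g := (weightInterpolation p hJ).toLinearMap) ?_ hx
  rintro _ ⟨u, rfl⟩
  ext s
  rw [h, AlgHom.toLinearMap_apply, weightInterpolation_apply, specialization_groupElement]

theorem weightInterpolation_injective (hJ : IsAdic J) {π : R} (hπ : J = Ideal.span {π})
    (hreg : IsLeftRegular π) {N : ℕ} (hN : 0 < N) (hpow : ∀ y : R, ¬ π ∣ y → π ∣ y ^ N - 1) :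
    Function.Injective (weightInterpolation p hJ) := by
  refine (injective_iff_map_eq_zero _).2 fun x hx => ?_
  exact eq_zero_of_forall_specialization_natCast hπ hreg hN hpow
    fun i => DFunLike.congr_fun hx (i : ℤ_[p])

theorem iInf_weightIdeal_eq_bot (hJ : IsAdic J)
    (hinj : Function.Injective (weightInterpolation p hJ)) {I : Set ℤ_[p]} (hI : Dense I) :
    ⨅ k ∈ I, weightIdeal J p k = ⊥ := by
  have := t2Space_of_isAdic hJ
  refine eq_bot_iff.2 fun x hx => ?_
  simp only [Submodule.mem_iInf] at hx
  rw [Ideal.mem_bot]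
  refine hinj (DFunLike.coe_injective ?_)
  rw [map_zero]
  exact (weightInterpolation p hJ x).continuous.ext_on hI continuous_const fun k hk => hx k hk

end Topology

/-- The closure is the zero locus of the intersection of the primes, here `V(0)`. -/
theorem dense_setOf_asIdeal_eq {A ι : Type*} [CommRing A] {P : ι → Ideal A}
    (hP : ∀ k, (P k).IsPrime) {I : Set ι} (h : ⨅ k ∈ I, P k = ⊥) :
    Dense {x : PrimeSpectrum A | ∃ k ∈ I, x.asIdeal = P k} := by
  rw [dense_iff_closure_eq, ← PrimeSpectrum.zeroLocus_vanishingIdeal_eq_closure]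
  have hv : PrimeSpectrum.vanishingIdeal {x : PrimeSpectrum A | ∃ k ∈ I, x.asIdeal = P k} = ⊥ := by
    refine eq_bot_iff.2 (le_trans (le_iInf₂ fun k hk a ha => ?_) h.le)
    exact (PrimeSpectrum.mem_vanishingIdeal _ _).1 ha ⟨P k, hP k⟩ ⟨k, hk, rfl⟩
  rw [hv]
  simp

/-! ### Arithmetic of `A_𝔭`: regularity, primality and residue field. -/

section Completion

variable {F : Type*} [Field F] {ϖ : F[X]}

theorem completedIdeal_eq_span :
    completedIdeal ϖ = Ideal.span {algebraMap F[X] (CompletedRing ϖ) ϖ} := by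
  rw [completedIdeal, Ideal.map_span, Set.image_singleton]

theorem ker_evalOne_eq_completedIdeal :
    RingHom.ker (AdicCompletion.evalOneₐ (Ideal.span {ϖ})).toRingHom = completedIdeal ϖ :=
  AdicCompletion.ker_evalOneₐ_eq_map _ ⟨{ϖ}, by simp⟩

theorem isLeftRegular_algebraMap_completedRing (h0 : ϖ ≠ 0) :
    IsLeftRegular (algebraMap F[X] (CompletedRing ϖ) ϖ) := by
  intro a b hab
  -- Flatness of `A_𝔭` over `A` carries regularity of `ϖ` over from `A`.
  have h : IsSMulRegular (CompletedRing ϖ) ϖ :=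
    (IsSMulRegular.of_ne_zero h0).of_flat
  exact h (by simpa [Algebra.smul_def] using hab)

theorem algebraMap_dvd_iff_evalOne_eq_zero (y : CompletedRing ϖ) :
    algebraMap F[X] (CompletedRing ϖ) ϖ ∣ y ↔
      AdicCompletion.evalOneₐ (Ideal.span {ϖ}) y = 0 := by
  rw [← Ideal.mem_span_singleton, ← completedIdeal_eq_span, ← ker_evalOne_eq_completedIdeal]
  rfl

theorem prime_algebraMap_completedRing (hirr : Irreducible ϖ) :
    Prime (algebraMap F[X] (CompletedRing ϖ) ϖ) := by
  have : (Ideal.span {ϖ}).IsPrime := (Ideal.span_singleton_prime hirr.ne_zero).2 hirr.prime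
  have : (completedIdeal ϖ).IsPrime := by
    rw [← ker_evalOne_eq_completedIdeal]
    exact RingHom.ker_isPrime _
  have : Nontrivial (CompletedRing ϖ) :=
    (AdicCompletion.evalOneₐ (Ideal.span {ϖ})).toRingHom.domain_nontrivial
  rw [← Ideal.span_singleton_prime, ← completedIdeal_eq_span]
  · assumption
  · exact (isLeftRegular_algebraMap_completedRing hirr.ne_zero).ne_zero

theorem isDomain_completedRing (hirr : Irreducible ϖ) : IsDomain (CompletedRing ϖ) := by
  have : IsHausdorff (Ideal.span {algebraMap F[X] (CompletedRing ϖ) ϖ}) (CompletedRing ϖ) := by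
    rw [← completedIdeal_eq_span]; infer_instance
  exact isDomain_of_isHausdorff_span (prime_algebraMap_completedRing hirr)
    (isLeftRegular_algebraMap_completedRing hirr.ne_zero)

theorem exists_dvd_pow_sub_one [Finite F] (hmonic : ϖ.Monic) (hirr : Irreducible ϖ) :
    ∃ N : ℕ, 0 < N ∧ ∀ y : CompletedRing ϖ, ¬ algebraMap F[X] (CompletedRing ϖ) ϖ ∣ y →
      algebraMap F[X] (CompletedRing ϖ) ϖ ∣ y ^ N - 1 := by
  have : (Ideal.span {ϖ}).IsMaximal := PrincipalIdealRing.isMaximal_of_irreducible hirr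
  let := Ideal.Quotient.field (Ideal.span {ϖ})
  have : Module.Finite F (F[X] ⧸ Ideal.span {ϖ}) := hmonic.finite_quotient
  have : Finite (F[X] ⧸ Ideal.span {ϖ}) := Module.finite_of_finite F
  have := Fintype.ofFinite (F[X] ⧸ Ideal.span {ϖ})
  -- `N` is the order of the unit group of the residue field.
  refine ⟨Fintype.card (F[X] ⧸ Ideal.span {ϖ}) - 1, Nat.sub_pos_of_lt Fintype.one_lt_card,
    fun y hy => ?_⟩
  rw [algebraMap_dvd_iff_evalOne_eq_zero] at hy ⊢
  rw [map_sub, map_pow, map_one, FiniteField.pow_card_sub_one_eq_one _ hy, sub_self]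

end Completion

end

end IwasawaWeights

theorem mainTheorem10 (p : ℕ) [Fact p.Prime] {F : Type*} [Field F] [Finite F] [CharP F p]
    (ϖ : F[X]) (hmonic : ϖ.Monic) (hirr : Irreducible ϖ) :
    (∃ ι : iwasawaAlgebra (completedIdeal ϖ) →ₐ[CompletedRing ϖ] C(ℤ_[p], CompletedRing ϖ),
      Continuous ι ∧
      (∀ (u : OneUnits (completedIdeal ϖ)) (s : ℤ_[p]),
        ι (groupElement (completedIdeal ϖ) u) s = padicPow (completedIdeal ϖ) p u s) ∧
      (∀ ι' : iwasawaAlgebra (completedIdeal ϖ) →ₗ[CompletedRing ϖ] C(ℤ_[p], CompletedRing ϖ),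
        Continuous ι' →
        (∀ (u : OneUnits (completedIdeal ϖ)) (s : ℤ_[p]),
          ι' (groupElement (completedIdeal ϖ) u) s = padicPow (completedIdeal ϖ) p u s) →
        ι' = ι.toLinearMap) ∧
      Function.Injective ι) ∧
    (∀ k : ℤ_[p], (weightIdeal (completedIdeal ϖ) p k).IsPrime) ∧
    ∀ I : Set ℤ_[p], Dense I →
      Dense {x : PrimeSpectrum (iwasawaAlgebra (completedIdeal ϖ)) |
        ∃ k ∈ I, x.asIdeal = weightIdeal (completedIdeal ϖ) p k} ∧
      ⨅ k ∈ I, weightIdeal (completedIdeal ϖ) p k = ⊥ := by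
  have hJ : IsAdic (completedIdeal ϖ) := rfl
  obtain ⟨N, hN, hpow⟩ := exists_dvd_pow_sub_one hmonic hirr
  have hinj : Function.Injective (weightInterpolation p hJ) :=
    weightInterpolation_injective hJ completedIdeal_eq_span
      (isLeftRegular_algebraMap_completedRing hirr.ne_zero) hN hpow
  have := isDomain_completedRing hirr
  have hprime : ∀ k : ℤ_[p], (weightIdeal (completedIdeal ϖ) p k).IsPrime := fun k =>
    RingHom.ker_isPrime _
  refine ⟨⟨weightInterpolation p hJ, continuous_weightInterpolation hJ,
    fun u s => specialization_groupElement _ p s u,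
    fun ι' hι' h => eq_weightInterpolation hJ hι' h, hinj⟩, hprime, fun I hI => ?_⟩
  have h := iInf_weightIdeal_eq_bot hJ hinj hI
  exact ⟨dense_setOf_asIdeal_eq hprime h, h⟩
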